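/- Let $K=\mathbb{F}_q$ be a finite field with $q\neq 2$ elements. Let $\mathcal{C}$ be a clutter on the vertex set $\{y_1,\dots,y_n\}$, that is, a family of subsets (the edges) none of which is contained in another one, and assume that every edge of $\mathcal{C}$ is nonempty. Let $f_1,\dots,f_s$ be the distinct edges of $\mathcal{C}$, and let $v_i=(v_{i1},\dots,v_{in})\in\{0,1\}^n$ be the characteristic vector of $f_i$. Put $K^*=K\setminus\{0\}$ and $$X^*=\{(x_1^{v_{11}}\cdots x_n^{v_{1n}},\dots,x_1^{v_{s1}}\cdots x_n^{v_{sn}}) : x_1,\dots,x_n\in K^*\}\subset K^s,\qquad Y=\{[(a,1)] : a\in X^*\}\subset\mathbb{P}^s .$$ Let $I(X^*)\subset K[t_1,\dots,t_s]$ be the ideal of all polynomials that vanish on $X^*$, and let $I(Y)\subset K[t_1,\dots,t_{s+1}]$ be the ideal generated by the homogeneous polynomials that vanish on $Y$. The ideal $I(Y)$ is called a complete intersection if it can be generated by $s$ homogeneous polynomials. Then the following are equivalent: (a1) $I(Y)$ is a complete intersection. (a2) $I(Y)=(t_1^{q-1}-t_{s+1}^{q-1},\dots,t_s^{q-1}-t_{s+1}^{q-1})$.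 (a3) $X^*=(K^*)^s$, i.e. $X^*$ is the whole affine torus $\{(x_1,\dots,x_s) : x_i\in K^* \text{ for all } i\}$. (a4) $I(X^*)=(t_1^{q-1}-1,\dots,t_s^{q-1}-1)$. -/

import Mathlib

/-- A clutter on the vertex set `V`: a finite family of subsets of `V` (the edges), none of which
is contained in another one. -/
structure Clutter (V : Type*) where
  edges : Finset (Finset V)
  not_subset : ∀ e ∈ edges, ∀ f ∈ edges, e ≠ f → ¬ e ⊆ f

namespace Clutter

/-- The characteristic vectors of the edges of a clutter. -/
def charVec {V : Type*} [DecidableEq V] (C : Clutter V) (e : C.edges) (j : V) : ℕ :=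
  if j ∈ (e : Finset V) then 1 else 0

end Clutter

namespace ToricSet

/-- The affine algebraic toric set `X*` in `K^ι` parameterized by the monomials `y^(v i)`:
the points whose `i`-th coordinate is `∏ j, x j ^ (v i j)`, with all `x j` in `K*`. -/
def affine (K : Type*) [Field K] {ι V : Type*} [Fintype V] (v : ι → V → ℕ) : Set (ι → K) :=
  Set.range fun (x : V → Kˣ) (i : ι) => ∏ j, (x j : K) ^ v i j

/-- The affine torus `(K*)^ι`. -/
def affineTorus (K : Type*) [Field K] (ι : Type*) : Set (ι → K) :=
  {a | ∀ i, a i ≠ 0}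

/-- The vector `(a, 1)`; the additional, last coordinate has the index `none`. -/
def withOne {K : Type*} [Field K] {ι : Type*} (a : ι → K) : Option ι → K :=
  fun o => o.elim 1 a

theorem withOne_ne_zero {K : Type*} [Field K] {ι : Type*} (a : ι → K) : withOne a ≠ 0 :=
  fun h => one_ne_zero (α := K) (congrFun h none)

/-- The set `Y` of the points `[(a, 1)]` with `a` in `X*`, in the projective space with homogeneous
coordinates indexed by `Option ι`. -/
def projClosure (K : Type*) [Field K] {ι V : Type*} [Fintype V] (v : ι → V → ℕ) :
    Set (Projectivization K (Option ι → K)) :=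
  (fun a : ι → K => Projectivization.mk K (withOne a) (withOne_ne_zero a)) '' affine K v

end ToricSet

namespace ProjIdeal

/-- The polynomial `f` vanishes on the set `Z` of projective points: it is zero at all homogeneous
coordinate vectors of all points of `Z`. -/
def VanishesOn {K : Type*} [Field K] {σ : Type*} (f : MvPolynomial σ K)
    (Z : Set (Projectivization K (σ → K))) : Prop :=
  ∀ (w : σ → K) (hw : w ≠ 0), Projectivization.mk K w hw ∈ Z → MvPolynomial.eval w f = 0

/-- The vanishing ideal of a set of projective points: the ideal generated by the homogeneous
polynomials that vanish on it. -/
noncomputable def vanishing {K : Type*} [Field K] {σ : Type*}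
    (Z : Set (Projectivization K (σ → K))) : Ideal (MvPolynomial σ K) :=
  Ideal.span {f | (∃ d : ℕ, f.IsHomogeneous d) ∧ VanishesOn f Z}

/-- The ideal `I` can be generated by `s` homogeneous polynomials. -/
def GeneratedByHomogeneous {K : Type*} [Field K] {σ : Type*}
    (I : Ideal (MvPolynomial σ K)) (s : ℕ) : Prop :=
  ∃ g : Fin s → MvPolynomial σ K,
    (∀ k, ∃ d : ℕ, (g k).IsHomogeneous d) ∧ I = Ideal.span (Set.range g)

end ProjIdeal

/-- `I(Y)` is a complete intersection: it can be generated by `s` homogeneous polynomials,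
where `s` is the number of edges. -/
def Clutter.IsCompleteIntersection (K : Type*) [Field K] {V : Type*} [Fintype V] [DecidableEq V]
    (C : Clutter V) : Prop :=
  ProjIdeal.GeneratedByHomogeneous
    (ProjIdeal.vanishing (ToricSet.projClosure K C.charVec)) C.edges.card

open MvPolynomial

/-! The hard step is from a complete intersection to the explicit generators `F e`, the differences
of (q-1)-th powers. Clutter combinatorics show that elements of I(Y) have no pure power of any `t_e`
below degree q-1 (`coeff_single_eq_zero_of_mem_vanishing`). If homogeneous `g` generate I(Y), write
`F = A g`; comparing coefficients of `t_e^(q-1)` makes the constant-term matrix of `A` invertible,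
and the adjugate puts `g` into the homogeneous ideal of the `F e`
(`mem_span_of_det_constantCoeff_ne_zero`). The full torus yields both explicit ideals by the
combinatorial Nullstellensatz. Conversely, the explicit generators vanish on the whole torus, while
a polynomial separates any torus point outside X* from X*. -/

/-! ### Vanishing on torus grids. -/

theorem FiniteField.prod_units_sub_mul_eq_pow_sub_pow {K R : Type*} [Field K] [Fintype K]
    [DecidableEq K]
    [CommRing R] [IsDomain R] [Algebra K R] (x y : R) :
    ∏ u : Kˣ, (x - algebraMap K R u * y) =
      x ^ (Fintype.card K - 1) - y ^ (Fintype.card K - 1) := by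
  classical
  have hpos : 0 < Fintype.card K - 1 := Nat.sub_pos_of_lt Fintype.one_lt_card
  have hcard : Fintype.card Kˣ = Fintype.card K - 1 := Fintype.card_units K
  obtain ⟨g, hg⟩ := IsCyclic.exists_generator (α := Kˣ)
  have hinj : Function.Injective fun u : Kˣ => algebraMap K R u :=
    (algebraMap K R).injective.comp Units.val_injective
  have hprim : IsPrimitiveRoot (algebraMap K R g) (Fintype.card K - 1) := by
    have h := IsPrimitiveRoot.orderOf g
    rw [orderOf_eq_card_of_forall_mem_zpowers hg, Nat.card_eq_fintype_card, hcard] at h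
    exact (IsPrimitiveRoot.coe_units_iff.2 h).map_of_injective (algebraMap K R).injective
  have himage : Finset.univ.image (fun u : Kˣ => algebraMap K R u) =
      Polynomial.nthRootsFinset (Fintype.card K - 1) (1 : R) := by
    apply Finset.eq_of_subset_of_card_le
    · intro r hr
      obtain ⟨u, -, rfl⟩ := Finset.mem_image.1 hr
      rw [Polynomial.mem_nthRootsFinset hpos, ← map_pow, FiniteField.pow_card_sub_one_eq_one _ u.ne_zero,
        map_one]
    · rw [hprim.card_nthRootsFinset, Finset.card_image_of_injective _ hinj, Finset.card_univ, hcard]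
  rw [hprim.pow_sub_pow_eq_prod_sub_mul x y hpos, ← himage,
    Finset.prod_image fun a _ b _ h => hinj h]

namespace MvPolynomial

/-- A polynomial vanishing at all points of the grid `(K* y)^ι`, with `y ≠ 0`, lies in the ideal
generated by the polynomials `X i ^ (q - 1) - y ^ (q - 1)`. -/
theorem mem_span_of_eval_units_mul_eq_zero {K R ι : Type*} [Field K] [Fintype K]
    [CommRing R] [IsDomain R] [Algebra K R] [Finite ι] {y : R} (hy : y ≠ 0) (f : MvPolynomial ι R)
    (hf : ∀ u : ι → Kˣ, eval (fun i => algebraMap K R (u i) * y) f = 0) :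
    f ∈ Ideal.span (Set.range fun i : ι =>
      (X i ^ (Fintype.card K - 1) - C y ^ (Fintype.card K - 1) : MvPolynomial ι R)) := by
  classical
  have hinj : Function.Injective fun u : Kˣ => algebraMap K R u * y :=
    (mul_left_injective₀ hy).comp ((algebraMap K R).injective.comp Units.val_injective)
  obtain ⟨h, -, hfh⟩ := combinatorial_nullstellensatz_exists_linearCombination
    (fun _ : ι => Finset.univ.image fun u : Kˣ => algebraMap K R u * y)
    (fun _ => Finset.univ_nonempty.image _) f (by
      intro x hx
      choose u hu using fun i => Finset.mem_image.1 (hx i)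
      rw [show x = fun i => algebraMap K R (u i) * y from _root_.funext fun i => (hu i).2.symm]
      exact hf u)
  rw [hfh, Finsupp.linearCombination_apply]
  refine Submodule.sum_mem _ fun i _ => Ideal.mul_mem_left _ _ (Ideal.subset_span ⟨i, ?_⟩)
  dsimp only
  rw [Finset.prod_image fun a _ b _ h => hinj h,
    ← FiniteField.prod_units_sub_mul_eq_pow_sub_pow (K := K)]
  refine Finset.prod_congr rfl fun u _ => ?_
  rw [map_mul]
  rfl

/-! ### Homogeneous polynomials and ideals. -/

theorem IsHomogeneous.aeval_mul {R S σ : Type*} [CommSemiring R] [CommSemiring S] [Algebra R S]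
    {f : MvPolynomial σ R} {d : ℕ} (hf : f.IsHomogeneous d) (y : S) (w : σ → S) :
    MvPolynomial.aeval (fun i => y * w i) f = y ^ d * MvPolynomial.aeval w f := by
  simp_rw [aeval_def, eval₂_eq, Finset.mul_sum]
  refine Finset.sum_congr rfl fun b hb => ?_
  rw [hf.degree_eq_sum_deg_support hb, mul_left_comm, ← Finset.prod_pow_eq_pow_sum,
    ← Finset.prod_mul_distrib]
  simp_rw [mul_pow]

theorem IsHomogeneous.homogeneousComponent_mul {R σ : Type*} [CommSemiring R]
    {g : MvPolynomial σ R} {d : ℕ} (hg : g.IsHomogeneous d) (u : MvPolynomial σ R) :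
    homogeneousComponent d (u * g) = C (coeff 0 u) * g := by
  classical
  ext b
  rw [coeff_homogeneousComponent, coeff_C_mul]
  split_ifs with hb
  · rw [coeff_mul]
    refine Finset.sum_eq_single (0, b) ?_ (fun h => (h (by simp)).elim)
    rintro ⟨x, y⟩ hxy hne
    rw [Finset.HasAntidiagonal.mem_antidiagonal] at hxy
    dsimp only at hxy ⊢
    by_cases hy : y.degree = d
    · have hx : x.degree = 0 := by
        have := congrArg Finsupp.degree hxy
        rw [map_add] at this
        omega
      rw [Finsupp.degree_eq_zero_iff] at hx
      subst hx
      rw [zero_add] at hxy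
      exact (hne (by rw [hxy])).elim
    · rw [hg.coeff_eq_zero hy, mul_zero]
  · rw [hg.coeff_eq_zero hb, mul_zero]

attribute [local instance] MvPolynomial.gradedAlgebra

/-- The degree-`d` component of `u * g` is the constant term of `u`, a unit, times `g`. -/
theorem mem_of_mul_mem_of_isHomogeneous {K σ : Type*} [Field K] {J : Ideal (MvPolynomial σ K)}
    (hJ : J.IsHomogeneous (homogeneousSubmodule σ K)) {g u : MvPolynomial σ K} {d : ℕ}
    (hg : g.IsHomogeneous d) (hu : coeff 0 u ≠ 0) (h : u * g ∈ J) : g ∈ J := by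
  have h1 := homogeneousComponent_mem_of_mem hJ h (n := d)
  rw [hg.homogeneousComponent_mul] at h1
  have h2 := J.mul_mem_left (C (coeff 0 u)⁻¹) h1
  rwa [← mul_assoc, ← C_mul, inv_mul_cancel₀ hu, C_1, one_mul] at h2

/-- If the homogeneous polynomials `g k` generate an ideal containing the polynomials
`F i = ∑ k, A i k * g k`, whose number is the same, and the matrix of the constant terms of `A` is
invertible, then the homogeneous ideal generated by the `F i` contains the `g k`. -/
theorem mem_span_of_det_constantCoeff_ne_zero {K σ ι : Type*} [Field K] [Fintype ι] [DecidableEq ι]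
    (F g : ι → MvPolynomial σ K) (A : Matrix ι ι (MvPolynomial σ K))
    (hFh : ∀ i, ∃ d, (F i).IsHomogeneous d) (hg : ∀ k, ∃ d, (g k).IsHomogeneous d)
    (hF : A.mulVec g = F) (hA : (A.map (constantCoeff (R := K) (σ := σ))).det ≠ 0) (k : ι) :
    g k ∈ Ideal.span (Set.range F) := by
  obtain ⟨d, hd⟩ := hg k
  have hJ : (Ideal.span (Set.range F)).IsHomogeneous (homogeneousSubmodule σ K) := by
    refine Ideal.homogeneous_span _ _ ?_
    rintro _ ⟨i, rfl⟩
    exact hFh i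
  refine mem_of_mul_mem_of_isHomogeneous hJ hd (u := A.det) ?_ ?_
  · rw [← constantCoeff_eq, RingHom.map_det]
    exact hA
  · have h : A.adjugate.mulVec F = A.det • g := by
      rw [← hF, Matrix.mulVec_mulVec, Matrix.adjugate_mul, Matrix.smul_mulVec, Matrix.one_mulVec]
    have hk := congrFun h k
    rw [Pi.smul_apply, smul_eq_mul] at hk
    rw [← hk]
    exact Submodule.sum_mem _ fun i _ =>
      Ideal.mul_mem_left _ _ (Ideal.subset_span (Set.mem_range_self i))

end MvPolynomial

/-! ### The full torus and the explicit ideals. -/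

namespace ToricSet

variable {K : Type*} [Field K] {ι V : Type*} [Fintype V]

theorem affine_subset_affineTorus (v : ι → V → ℕ) : affine K v ⊆ affineTorus K ι := by
  rintro _ ⟨x, rfl⟩ i
  exact Finset.prod_ne_zero_iff.2 fun j _ => pow_ne_zero _ (x j).ne_zero

theorem eval_withOne_eq_zero {v : ι → V → ℕ} {f : MvPolynomial (Option ι) K}
    (hf : f ∈ ProjIdeal.vanishing (projClosure K v)) {a : ι → K} (ha : a ∈ affine K v) :
    eval (withOne a) f = 0 := by
  have h : ProjIdeal.vanishing (projClosure K v) ≤ RingHom.ker (eval (withOne a)) := by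
    refine Ideal.span_le.2 ?_
    rintro p ⟨-, hp⟩
    exact hp _ (withOne_ne_zero a) ⟨a, ha, rfl⟩
  exact h hf

theorem exists_smul_of_mk_mem_projClosure {v : ι → V → ℕ} {w : Option ι → K} (hw : w ≠ 0)
    (h : Projectivization.mk K w hw ∈ projClosure K v) :
    ∃ a ∈ affine K v, ∃ c : Kˣ, w = c • withOne a := by
  obtain ⟨a, ha, h⟩ := h
  obtain ⟨c, hc⟩ := (Projectivization.mk_eq_mk_iff K _ _ _ hw).1 h
  exact ⟨a, ha, c⁻¹, by rw [← hc, inv_smul_smul]⟩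

theorem X_pow_sub_X_pow_mem_vanishing [Fintype K] (v : ι → V → ℕ) (i : ι) :
    (X (some i) ^ (Fintype.card K - 1) - X none ^ (Fintype.card K - 1) :
      MvPolynomial (Option ι) K) ∈ ProjIdeal.vanishing (projClosure K v) := by
  refine Ideal.subset_span ⟨⟨_, (isHomogeneous_X_pow _ _).sub (isHomogeneous_X_pow _ _)⟩, ?_⟩
  intro w hw h
  obtain ⟨a, ha, c, rfl⟩ := exists_smul_of_mk_mem_projClosure hw h
  have h0 := affine_subset_affineTorus v ha i
  simp [Units.smul_def, withOne, mul_pow, FiniteField.pow_card_sub_one_eq_one _ h0]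

theorem affine_eq_affineTorus_of_vanishing_eq [Fintype K] [Fintype ι] (v : ι → V → ℕ)
    (h : ProjIdeal.vanishing (projClosure K v) = Ideal.span (Set.range fun i : ι =>
      (X (some i) ^ (Fintype.card K - 1) - X none ^ (Fintype.card K - 1) :
        MvPolynomial (Option ι) K))) :
    affine K v = affineTorus K ι := by
  classical
  refine (affine_subset_affineTorus v).antisymm fun a ha => ?_
  by_contra hna
  have hne : ∀ x : affine K v, ∃ i, a i ≠ x.1 i := fun x => by
    by_contra! hx
    exact hna (_root_.funext hx ▸ x.2)
  choose i hi using hne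
  have : Finite (affine K v) := Subtype.finite
  have := Fintype.ofFinite (affine K v)
  -- A product of linear forms, one for each point of X*: each kills its point and is nonzero at
  -- `(a, 1)`.
  let p : MvPolynomial (Option ι) K :=
    ∏ x : affine K v, (X (some (i x)) - C (x.1 (i x)) * X none)
  have hp : p ∈ ProjIdeal.vanishing (projClosure K v) := by
    refine Ideal.subset_span ⟨⟨_, IsHomogeneous.prod _ _ (fun _ => 1) fun x _ =>
      (isHomogeneous_X _ _).sub (isHomogeneous_C_mul_X _ _)⟩, ?_⟩
    intro w hw hwm
    obtain ⟨b, hb, c, rfl⟩ := exists_smul_of_mk_mem_projClosure hw hwm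
    rw [map_prod]
    refine Finset.prod_eq_zero (Finset.mem_univ ⟨b, hb⟩) ?_
    simp [Units.smul_def, withOne, mul_comm]
  have hker : ProjIdeal.vanishing (projClosure K v) ≤ RingHom.ker (eval (withOne a)) := by
    rw [h]
    refine Ideal.span_le.2 ?_
    rintro _ ⟨j, rfl⟩
    simp [RingHom.mem_ker, withOne, FiniteField.pow_card_sub_one_eq_one _ (ha j)]
  have h0 : eval (withOne a) p = 0 := hker hp
  rw [map_prod, Finset.prod_eq_zero_iff] at h0
  obtain ⟨x, -, hx⟩ := h0
  refine hi x (sub_eq_zero.1 ?_)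
  simpa [withOne] using hx

theorem affine_eq_affineTorus_of_vanishingIdeal_eq [Fintype K] [Fintype ι] (v : ι → V → ℕ)
    (h : vanishingIdeal K (affine K v) = Ideal.span (Set.range fun i : ι =>
      (X i ^ (Fintype.card K - 1) - 1 : MvPolynomial ι K))) :
    affine K v = affineTorus K ι := by
  classical
  refine (affine_subset_affineTorus v).antisymm fun a ha => ?_
  by_contra hna
  have hp : indicator a ∈ vanishingIdeal K (affine K v) := fun x hx => by
    rw [aeval_eq_eval]
    exact eval_indicator_apply_eq_zero _ _ (by rintro rfl; exact hna hx)
  have hker : vanishingIdeal K (affine K v) ≤ RingHom.ker (eval a) := by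
    rw [h]
    refine Ideal.span_le.2 ?_
    rintro _ ⟨j, rfl⟩
    simp [RingHom.mem_ker, FiniteField.pow_card_sub_one_eq_one _ (ha j)]
  have h0 : eval a (indicator a) = 0 := hker hp
  rw [eval_indicator_apply_eq_one] at h0
  exact one_ne_zero h0

theorem vanishingIdeal_affine_eq_span [Fintype K] [Finite ι] (v : ι → V → ℕ)
    (h : affine K v = affineTorus K ι) :
    vanishingIdeal K (affine K v) = Ideal.span (Set.range fun i : ι =>
      (X i ^ (Fintype.card K - 1) - 1 : MvPolynomial ι K)) := by
  rw [h]
  refine le_antisymm (fun f hf => ?_) (Ideal.span_le.2 ?_)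
  · have := mem_span_of_eval_units_mul_eq_zero (K := K) (y := (1 : K)) one_ne_zero f fun u => by
      rw [← aeval_eq_eval]
      exact hf _ fun i => by simp
    simpa using this
  · rintro _ ⟨i, rfl⟩ a ha
    simp [FiniteField.pow_card_sub_one_eq_one _ (ha i)]

theorem vanishing_projClosure_eq_span [Fintype K] [Finite ι] (v : ι → V → ℕ)
    (h : affine K v = affineTorus K ι) :
    ProjIdeal.vanishing (projClosure K v) = Ideal.span (Set.range fun i : ι =>
      (X (some i) ^ (Fintype.card K - 1) - X none ^ (Fintype.card K - 1) :
        MvPolynomial (Option ι) K)) := by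
  refine le_antisymm (Ideal.span_le.2 ?_) (Ideal.span_le.2 ?_)
  · rintro f ⟨⟨d, hd⟩, hf⟩
    -- The last variable becomes the scalar `y` of the domain `K[y]`; by homogeneity the value at `u
    -- * y` is `y ^ d` times the value at `(u, 1)`, which is zero.
    have hmem := mem_span_of_eval_units_mul_eq_zero (K := K) (y := (Polynomial.X : Polynomial K))
      Polynomial.X_ne_zero (optionEquivRight K ι f) fun u => by
        have hu : (fun i => (u i : K)) ∈ affine K v := by
          rw [h]
          exact fun i => (u i).ne_zero
        have h0 : eval (withOne fun i => (u i : K)) f = 0 :=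
          hf _ (withOne_ne_zero _) ⟨_, hu, rfl⟩
        have hcomp : (eval fun i => algebraMap K (Polynomial K) (u i) * Polynomial.X).comp
            (optionEquivRight K ι : MvPolynomial (Option ι) K →+* _) =
            (aeval fun o => Polynomial.X * algebraMap K (Polynomial K)
              (withOne (fun i => (u i : K)) o) : _ →ₐ[K] Polynomial K) := by
          refine ringHom_ext (fun r => ?_) fun o => ?_
          · simp
          · cases o <;> simp [withOne]
        refine (RingHom.congr_fun hcomp f).trans ((hd.aeval_mul _ _).trans ?_)
        have h1 := aeval_algebraMap_apply (Polynomial K) (withOne fun i => (u i : K)) f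
        rw [aeval_eq_eval, h0, map_zero] at h1
        exact (congrArg _ h1).trans (mul_zero _)
    have := Ideal.mem_map_of_mem (optionEquivRight K ι).symm hmem
    rw [AlgEquiv.symm_apply_apply, Ideal.map_span, ← Set.range_comp] at this
    have hgen : (fun i : ι => (X (some i) ^ (Fintype.card K - 1) - X none ^ (Fintype.card K - 1) :
        MvPolynomial (Option ι) K)) = (optionEquivRight K ι).symm ∘ fun i =>
          X i ^ (Fintype.card K - 1) - C Polynomial.X ^ (Fintype.card K - 1) := by
      refine _root_.funext fun i => (optionEquivRight K ι).injective ?_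
      simp
    rwa [hgen]
  · rintro _ ⟨i, rfl⟩
    exact X_pow_sub_X_pow_mem_vanishing v i

end ToricSet

/-! ### Substituting monomials in the vertices. -/

namespace ToricSet

variable {K : Type*} [Field K] {ι V : Type*} [Fintype V]

/-- Exponents of the monomial in `V` obtained from `t^b` by substituting `∏ j, y j ^ v i j` for
`t i` and `1` for the last variable. -/
noncomputable def substExponent [Fintype ι] (v : ι → V → ℕ) (b : Option ι →₀ ℕ) : V →₀ ℕ :=
  Finsupp.equivFunOnFinite.symm fun j => ∑ i, b (some i) * v i j

theorem substExponent_apply [Fintype ι] (v : ι → V → ℕ) (b : Option ι →₀ ℕ) (j : V) :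
    substExponent v b j = ∑ i, b (some i) * v i j := rfl

theorem substExponent_le_degree [Fintype ι] {v : ι → V → ℕ} (hv : ∀ i j, v i j ≤ 1)
    (b : Option ι →₀ ℕ) (j : V) : substExponent v b j ≤ b.degree := by
  rw [substExponent_apply, Finsupp.degree_eq_sum, Fintype.sum_option]
  exact (Finset.sum_le_sum fun i _ => mul_le_of_le_one_right (Nat.zero_le _) (hv i j)).trans
    (Nat.le_add_left _ _)

/-- As exponents are 0 or 1, substitution gives degree at most `d < q - 1` in each vertex variable,
too small to vanish on the grid of units unless zero. -/
theorem sum_monomial_substExponent_eq_zero [Fintype K] [Fintype ι] {v : ι → V → ℕ}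
    (hv : ∀ i j, v i j ≤ 1) {f : MvPolynomial (Option ι) K} {d : ℕ} (hf : f.IsHomogeneous d)
    (hd : d < Fintype.card K - 1) (h0 : ∀ a ∈ affine K v, eval (withOne a) f = 0) :
    ∑ b ∈ f.support, monomial (substExponent v b) (coeff b f) = 0 := by
  classical
  refine eq_zero_of_eval_zero_at_prod_finset _
    (fun _ => Finset.univ.image fun u : Kˣ => (u : K)) (fun j => ?_) fun x hx => ?_
  · rw [Finset.card_image_of_injective _ Units.val_injective, Finset.card_univ,
      Fintype.card_units]
    refine lt_of_le_of_lt ((degreeOf_sum_le j _ _).trans (Finset.sup_le fun b hb => ?_)) hd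
    refine degreeOf_le_iff.2 fun m hm => ?_
    rw [Finset.mem_singleton.1 (support_monomial_subset hm)]
    refine (substExponent_le_degree hv b j).trans_eq ?_
    by_contra hne
    exact mem_support_iff.1 hb (hf.coeff_eq_zero hne)
  · choose u hu using fun j => Finset.mem_image.1 (hx j)
    obtain rfl : (fun j => (u j : K)) = x := _root_.funext fun j => (hu j).2
    rw [← h0 _ ⟨u, rfl⟩, map_sum, eval_eq']
    refine Finset.sum_congr rfl fun b _ => ?_
    rw [eval_monomial, Finsupp.prod_fintype _ _ fun _ => pow_zero _, Fintype.prod_option]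
    simp only [withOne, Option.elim, one_pow, one_mul, substExponent_apply, ← Finset.prod_pow,
      ← pow_mul]
    rw [Finset.prod_comm]
    simp only [Finset.prod_pow_eq_pow_sum, mul_comm]

end ToricSet

/-! ### Pure powers, clutters and complete intersections. -/

namespace MvPolynomial

theorem coeff_single_mul {R σ : Type*} [CommSemiring R] (p f : MvPolynomial σ R) (i : σ) (d : ℕ) :
    coeff (Finsupp.single i d) (p * f) = ∑ k ∈ Finset.HasAntidiagonal.antidiagonal d,
      coeff (Finsupp.single i k.1) p * coeff (Finsupp.single i k.2) f := by
  classical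
  rw [coeff_mul, Finsupp.antidiagonal_single, Finset.sum_map]
  rfl

theorem coeff_single_X_pow_sub_X_pow {R σ : Type*} [CommRing R] [DecidableEq σ] {n : ℕ}
    (hn : n ≠ 0) (i e : σ) :
    coeff (Finsupp.single (some e) n) (X (some i) ^ n - X none ^ n : MvPolynomial (Option σ) R) =
      if i = e then 1 else 0 := by
  simp [coeff_X_pow, Finsupp.single_left_inj hn]

end MvPolynomial

namespace Clutter

variable {K : Type*} [Field K] {V : Type*} [DecidableEq V] (C : Clutter V)

theorem charVec_le_one (e : C.edges) (j : V) : C.charVec e j ≤ 1 := by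
  unfold charVec
  split_ifs <;> simp

variable [Fintype V]

/-- In a clutter without empty edges, a monomial of degree `d` that is sent to the same monomial as
`t_e ^ d` equals `t_e ^ d`. -/
theorem eq_single_of_substExponent_eq (hC : ∅ ∉ C.edges) (e : C.edges) {d : ℕ}
    {b : Option C.edges →₀ ℕ} (hb : b.degree = d)
    (h : ToricSet.substExponent C.charVec b =
      ToricSet.substExponent C.charVec (Finsupp.single (some e) d)) :
    b = Finsupp.single (some e) d := by
  classical
  have hle : ∀ j ∈ e.1, ∑ e' : C.edges, b (some e') * C.charVec e' j = d := by
    intro j hj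
    have := DFunLike.congr_fun h j
    rw [ToricSet.substExponent_apply, ToricSet.substExponent_apply,
      Finset.sum_eq_single (s := Finset.univ)
        (f := fun i => Finsupp.single (some e) d (some i) * C.charVec i j) e
        (fun e' _ hne => by
          rw [Finsupp.single_eq_of_ne (by simpa using hne), zero_mul]) (by simp)] at this
    rw [this, Finsupp.single_eq_same, charVec, if_pos hj, mul_one]
  rw [Finsupp.degree_eq_sum, Fintype.sum_option] at hb
  have hmul : ∀ j e', b (some e') * C.charVec e' j ≤ b (some e') := fun j e' =>
    mul_le_of_le_one_right (Nat.zero_le _) (C.charVec_le_one e' j)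
  obtain ⟨j₀, hj₀⟩ : e.1.Nonempty := by
    rw [Finset.nonempty_iff_ne_empty]
    exact fun h0 => hC (h0 ▸ e.2)
  -- The edges containing one vertex of `e` already use up the total degree `d`.
  have hnone : b none = 0 := by
    have h1 := Finset.sum_le_sum fun e' (_ : e' ∈ Finset.univ) => hmul j₀ e'
    rw [hle j₀ hj₀] at h1
    omega
  have hsome : ∀ e', e' ≠ e → b (some e') = 0 := by
    -- A vertex of `e` outside `e'` exists by the clutter property; a positive exponent at `e'`
    -- would leave less than `d` there.
    intro e' hne
    obtain ⟨j, hj, hj'⟩ := Finset.not_subset.1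
      (C.not_subset e.1 e.2 e'.1 e'.2 fun h => hne (Subtype.ext h.symm))
    by_contra hpos
    refine absurd (hle j hj) (ne_of_lt ?_)
    refine lt_of_lt_of_le (Finset.sum_lt_sum (fun i _ => hmul j i) ⟨e', Finset.mem_univ _, ?_⟩)
      (by omega : ∑ e', b (some e') ≤ d)
    simpa [charVec, hj'] using Nat.pos_of_ne_zero hpos
  ext o
  rcases o with _ | e'
  · simpa using hnone
  · by_cases hne : e' = e
    · subst hne
      rw [hnone, zero_add, Finset.sum_eq_single e' (fun i _ hi => hsome i hi) (by simp)] at hb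
      simpa using hb
    · rw [hsome e' hne, Finsupp.single_eq_of_ne (by simpa using hne)]

theorem coeff_single_eq_zero_of_isHomogeneous [Fintype K] (hC : ∅ ∉ C.edges) (e : C.edges)
    {f : MvPolynomial (Option C.edges) K} {n : ℕ} (hf : f.IsHomogeneous n)
    (h0 : ∀ a ∈ ToricSet.affine K C.charVec, eval (ToricSet.withOne a) f = 0) {d : ℕ}
    (hd : d < Fintype.card K - 1) : coeff (Finsupp.single (some e) d) f = 0 := by
  classical
  by_cases hn : d = n
  · subst hn
    have h := congrArg (coeff (ToricSet.substExponent C.charVec (Finsupp.single (some e) d)))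
      (ToricSet.sum_monomial_substExponent_eq_zero C.charVec_le_one hf hd h0)
    rw [coeff_sum, coeff_zero] at h
    simp only [coeff_monomial] at h
    rw [Finset.sum_eq_single (Finsupp.single (some e) d)] at h
    · simpa using h
    · intro b hb hne
      refine if_neg fun hL => hne (C.eq_single_of_substExponent_eq hC e ?_ hL)
      by_contra hdeg
      exact mem_support_iff.1 hb (hf.coeff_eq_zero hdeg)
    · intro hmem
      simpa using hmem
  · exact hf.coeff_eq_zero (by simpa using hn)

/-- Divisors of a pure power are pure powers of no larger degree, so the homogeneous case survives
multiplication by any polynomial. -/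
theorem coeff_single_eq_zero_of_mem_vanishing [Fintype K] (hC : ∅ ∉ C.edges) (e : C.edges)
    {f : MvPolynomial (Option C.edges) K}
    (hf : f ∈ ProjIdeal.vanishing (ToricSet.projClosure K C.charVec)) {d : ℕ}
    (hd : d < Fintype.card K - 1) : coeff (Finsupp.single (some e) d) f = 0 := by
  induction hf using Submodule.span_induction generalizing d with
  | mem f hf =>
    obtain ⟨⟨n, hn⟩, hv⟩ := hf
    exact C.coeff_single_eq_zero_of_isHomogeneous hC e hn
      (fun a ha => hv _ (ToricSet.withOne_ne_zero a) ⟨a, ha, rfl⟩) hd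
  | zero => rw [coeff_zero]
  | add f g _ _ hf hg => rw [coeff_add, hf hd, hg hd, add_zero]
  | smul p f _ hf =>
    rw [smul_eq_mul, coeff_single_mul]
    refine Finset.sum_eq_zero fun k hk => ?_
    rw [Finset.HasAntidiagonal.mem_antidiagonal] at hk
    rw [hf (by omega), mul_zero]

theorem vanishing_eq_span_of_isCompleteIntersection [Fintype K] (hC : ∅ ∉ C.edges)
    (h : C.IsCompleteIntersection K) :
    ProjIdeal.vanishing (ToricSet.projClosure K C.charVec) =
      Ideal.span (Set.range fun e : C.edges =>
        (X (some e) ^ (Fintype.card K - 1) - X none ^ (Fintype.card K - 1) :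
          MvPolynomial (Option C.edges) K)) := by
  classical
  set F : C.edges → MvPolynomial (Option C.edges) K := fun e =>
    X (some e) ^ (Fintype.card K - 1) - X none ^ (Fintype.card K - 1) with hFdef
  have hq : 0 < Fintype.card K - 1 := Nat.sub_pos_of_lt Fintype.one_lt_card
  obtain ⟨g', hg', hI⟩ := h
  let g : C.edges → MvPolynomial (Option C.edges) K := g' ∘ C.edges.equivFin
  have hI : ProjIdeal.vanishing (ToricSet.projClosure K C.charVec) = Ideal.span (Set.range g) := by
    rw [hI, C.edges.equivFin.surjective.range_comp]
  have hFmem : ∀ e, F e ∈ ProjIdeal.vanishing (ToricSet.projClosure K C.charVec) := fun e =>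
    ToricSet.X_pow_sub_X_pow_mem_vanishing C.charVec e
  have hgmem : ∀ k, g k ∈ ProjIdeal.vanishing (ToricSet.projClosure K C.charVec) := fun k =>
    hI ▸ Ideal.subset_span (Set.mem_range_self k)
  have hA : ∀ e, ∃ c : C.edges → MvPolynomial (Option C.edges) K, ∑ k, c k * g k = F e := fun e =>
    Ideal.mem_span_range_iff_exists_fun.1 (hI ▸ hFmem e)
  choose A hA using hA
  refine le_antisymm ?_ (Ideal.span_le.2 (by rintro _ ⟨e, rfl⟩; exact hFmem e))
  rw [hI]
  refine Ideal.span_le.2 ?_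
  rintro _ ⟨k, rfl⟩
  refine mem_span_of_det_constantCoeff_ne_zero F g (Matrix.of A)
    (fun e => ⟨_, (isHomogeneous_X_pow _ _).sub (isHomogeneous_X_pow _ _)⟩)
    (fun k => hg' _) (_root_.funext hA) (fun hdet => ?_) k
  -- A left kernel vector `c` makes `∑ c i * F i` a combination of the `g k` with coefficients `p k`
  -- lacking constant terms.
  obtain ⟨c, hc, hcA⟩ := Matrix.exists_vecMul_eq_zero_iff.2 hdet
  refine hc (_root_.funext fun e => ?_)
  let p : C.edges → MvPolynomial (Option C.edges) K := fun k => ∑ i, MvPolynomial.C (c i) * A i k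
  have hp : ∀ k, coeff 0 (p k) = 0 := fun k => by
    have := congrFun hcA k
    simpa [p, Matrix.vecMul, dotProduct, coeff_sum, coeff_C_mul, constantCoeff_eq] using this
  have hsum : ∑ i, MvPolynomial.C (c i) * F i = ∑ k, p k * g k := by
    simp_rw [← hA, p, Finset.mul_sum, Finset.sum_mul]
    rw [Finset.sum_comm]
    simp_rw [mul_assoc]
  have hcoeff := congrArg (coeff (Finsupp.single (some e) (Fintype.card K - 1))) hsum
  rw [coeff_sum, coeff_sum, Finset.sum_eq_single e] at hcoeff
  -- Either the factor from `p k` is its zero constant term, or `g k` contributes a pure power below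
  -- degree q-1. The left side has coefficient `c e`.
  · have hz : ∀ k, coeff (Finsupp.single (some e) (Fintype.card K - 1)) (p k * g k) = 0 := by
      intro k
      rw [coeff_single_mul]
      refine Finset.sum_eq_zero fun ij hij => ?_
      rw [Finset.HasAntidiagonal.mem_antidiagonal] at hij
      rcases Nat.eq_zero_or_pos ij.1 with h0 | hpos
      · rw [h0, Finsupp.single_zero, hp, zero_mul]
      · rw [C.coeff_single_eq_zero_of_mem_vanishing hC e (hgmem k) (by omega), mul_zero]
    rw [Finset.sum_eq_zero fun k _ => hz k] at hcoeff
    rwa [coeff_C_mul, coeff_single_X_pow_sub_X_pow hq.ne', if_pos rfl, mul_one] at hcoeff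
  · intro i _ hne
    rw [coeff_C_mul, coeff_single_X_pow_sub_X_pow hq.ne', if_neg hne, mul_zero]
  · simp

theorem isCompleteIntersection_of_vanishing_eq_span [Fintype K]
    (h : ProjIdeal.vanishing (ToricSet.projClosure K C.charVec) =
      Ideal.span (Set.range fun e : C.edges =>
        (X (some e) ^ (Fintype.card K - 1) - X none ^ (Fintype.card K - 1) :
          MvPolynomial (Option C.edges) K))) :
    C.IsCompleteIntersection K := by
  refine ⟨(fun e : C.edges => X (some e) ^ (Fintype.card K - 1) -
    X none ^ (Fintype.card K - 1)) ∘ C.edges.equivFin.symm,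
    fun k => ⟨_, (isHomogeneous_X_pow _ _).sub (isHomogeneous_X_pow _ _)⟩, ?_⟩
  rw [h, C.edges.equivFin.symm.surjective.range_comp]

end Clutter

theorem mainTheorem1 {K : Type*} [Field K] [Fintype K] (hq : Fintype.card K ≠ 2)
    {V : Type*} [Fintype V] [DecidableEq V] (C : Clutter V) (hC : ∅ ∉ C.edges) :
    List.TFAE [
      C.IsCompleteIntersection K,
      ProjIdeal.vanishing (ToricSet.projClosure K C.charVec) =
        Ideal.span (Set.range fun e : C.edges =>
          (MvPolynomial.X (some e) ^ (Fintype.card K - 1) -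
            MvPolynomial.X none ^ (Fintype.card K - 1) : MvPolynomial (Option C.edges) K)),
      ToricSet.affine K C.charVec = ToricSet.affineTorus K C.edges,
      MvPolynomial.vanishingIdeal K (ToricSet.affine K C.charVec) =
        Ideal.span (Set.range fun e : C.edges =>
          (MvPolynomial.X e ^ (Fintype.card K - 1) - 1 : MvPolynomial C.edges K))] := by
  tfae_have 1 → 2 := C.vanishing_eq_span_of_isCompleteIntersection hC
  tfae_have 2 → 1 := C.isCompleteIntersection_of_vanishing_eq_span
  tfae_have 2 → 3 := ToricSet.affine_eq_affineTorus_of_vanishing_eq C.charVec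
  tfae_have 3 → 2 := ToricSet.vanishing_projClosure_eq_span C.charVec
  tfae_have 3 → 4 := ToricSet.vanishingIdeal_affine_eq_span C.charVec
  tfae_have 4 → 3 := ToricSet.affine_eq_affineTorus_of_vanishingIdeal_eq C.charVec
  tfae_finish
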